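/- Let $F$ be a field and $n\ge 0$ an integer. Call an ideal $\mathcal I\subseteq F[x_1,\dots,x_n]$ \emph{tame} if the blowup of $\mathbb A^n_F$ with center $\mathcal I$ is a smooth scheme over $F$. For a subset $I\subseteq\{1,\dots,n\}$, the \emph{coordinate ideal with cloud} $I$ is the ideal $(x_i : i\in I)$ of $F[x_1,\dots,x_n]$. Let $\mathcal I,\mathcal J,\mathcal K$ be the coordinate ideals with clouds $I,J,K\subseteq\{1,\dots,n\}$, respectively. (a) If $I\cup J=K$, then the product $\mathcal I\cdot\mathcal J\cdot\mathcal K$ is tame. (b) If $I\subseteq J\cup K$, $J\subseteq K\cup I$ and $K\subseteq I\cup J$, then the product $\mathcal I\cdot\mathcal J\cdot\mathcal K$ is tame. (If one of the three clouds is empty, the product is the zero ideal, whose blowup is the empty scheme, and the assertion is trivial.) -/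

import Mathlib

open AlgebraicGeometry CategoryTheory

universe u

namespace BlowupTame

section Rees

variable {R : Type u} [CommRing R] (I : Ideal R)

/-- The degree `i` part `I ^ i * t ^ i` of the Rees algebra `⨁ i, I ^ i * t ^ i`, which Mathlib
realizes inside the polynomial ring `R[t]`. -/
def reesPiece (i : ℕ) : Submodule R (reesAlgebra I) where
  carrier := {f | ∀ j, j ≠ i → (f : Polynomial R).coeff j = 0}
  zero_mem' := by intro j _; simp
  add_mem' := by
    intro f g hf hg j hj
    simp [hf j hj, hg j hj]
  smul_mem' := by
    intro r f hf j hj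
    simp [hf j hj]

theorem mem_reesPiece {i : ℕ} {f : reesAlgebra I} :
    f ∈ reesPiece I i ↔ ∀ j, j ≠ i → (f : Polynomial R).coeff j = 0 := Iff.rfl

/-- The homogeneous component of degree `i` of an element of the Rees algebra. -/
noncomputable def reesComponent (f : reesAlgebra I) (i : ℕ) : reesPiece I i :=
  ⟨⟨Polynomial.monomial i ((f : Polynomial R).coeff i), reesAlgebra.monomial_mem.mpr (f.2 i)⟩, by
    intro j hj
    simp [Polynomial.coeff_monomial, hj.symm]⟩

theorem reesComponent_of_mem {i : ℕ} (f : reesPiece I i) :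
    reesComponent I (f : reesAlgebra I) i = f := by
  apply Subtype.ext
  apply Subtype.ext
  ext j
  change (Polynomial.monomial i (((f : reesAlgebra I) : Polynomial R).coeff i)).coeff j = _
  rw [Polynomial.coeff_monomial]
  split_ifs with h
  · subst h
    rfl
  · exact (f.2 j (Ne.symm h)).symm

theorem reesComponent_of_mem_ne {i j : ℕ} (f : reesPiece I i) (h : j ≠ i) :
    reesComponent I (f : reesAlgebra I) j = 0 := by
  apply Subtype.ext
  apply Subtype.ext
  change Polynomial.monomial j (((f : reesAlgebra I) : Polynomial R).coeff j) = 0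
  rw [f.2 j h, map_zero]

instance reesPiece_gradedMonoid : SetLike.GradedMonoid (reesPiece I) where
  one_mem := by
    intro j hj
    simp [Polynomial.coeff_one, hj]
  mul_mem := by
    intro i j f g hf hg k hk
    change ((f : Polynomial R) * (g : Polynomial R)).coeff k = 0
    rw [Polynomial.coeff_mul]
    refine Finset.sum_eq_zero ?_
    rintro ⟨a, b⟩ hab
    have hab : a + b = k := Finset.HasAntidiagonal.mem_antidiagonal.mp hab
    change (f : Polynomial R).coeff a * (g : Polynomial R).coeff b = 0
    by_cases ha : a = i
    · have hb : b ≠ j := by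
        rintro rfl
        exact hk (by rw [← hab, ha])
      simp [hg b hb]
    · simp [hf a ha]

theorem reesComponent_add (f g : reesAlgebra I) (i : ℕ) :
    reesComponent I (f + g) i = reesComponent I f i + reesComponent I g i := by
  apply Subtype.ext
  apply Subtype.ext
  change Polynomial.monomial i (((f : Polynomial R) + (g : Polynomial R)).coeff i) = _
  rw [Polynomial.coeff_add, map_add]
  rfl

/-- The decomposition of an element of the Rees algebra into homogeneous components. -/
noncomputable def reesDecompose (f : reesAlgebra I) : DirectSum ℕ (fun i => reesPiece I i) :=
  DirectSum.mk (fun i => reesPiece I i) (f : Polynomial R).support (fun i => reesComponent I f i)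

theorem reesDecompose_apply (f : reesAlgebra I) (i : ℕ) :
    reesDecompose I f i = reesComponent I f i := by
  by_cases h : i ∈ (f : Polynomial R).support
  · exact DirectSum.mk_apply_of_mem h
  · refine (DirectSum.mk_apply_of_notMem h).trans ?_
    apply Subtype.ext
    apply Subtype.ext
    change 0 = Polynomial.monomial i ((f : Polynomial R).coeff i)
    rw [Polynomial.notMem_support_iff.mp h, map_zero]

noncomputable instance reesPiece_decomposition : DirectSum.Decomposition (reesPiece I) where
  decompose' := reesDecompose I
  left_inv := by
    intro f
    apply Subtype.ext
    change ((DirectSum.coeAddMonoidHom (reesPiece I) (reesDecompose I f) : reesAlgebra I) :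
      Polynomial R) = f
    have h : DirectSum.coeAddMonoidHom (reesPiece I) (reesDecompose I f) =
        ∑ i ∈ (f : Polynomial R).support, (reesComponent I f i : reesAlgebra I) := by
      have h' : reesDecompose I f = ∑ i ∈ (f : Polynomial R).support,
          DirectSum.of (fun i => reesPiece I i) i (reesComponent I f i) := by
        refine DFinsupp.ext fun j => ?_
        rw [reesDecompose_apply, DFinsupp.finsetSum_apply]
        by_cases hj : j ∈ (f : Polynomial R).support
        · rw [Finset.sum_eq_single j]
          · exact (DirectSum.of_eq_same (β := fun i => reesPiece I i) j
              (reesComponent I f j)).symm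
          · intro i _ hij
            exact DirectSum.of_eq_of_ne _ _ _ hij.symm
          · exact fun h => absurd hj h
        · rw [Finset.sum_eq_zero]
          · rw [← reesDecompose_apply]
            exact DirectSum.mk_apply_of_notMem hj
          · intro i hi
            exact DirectSum.of_eq_of_ne _ _ _ (fun h => hj (h ▸ hi))
      rw [h', map_sum]
      exact Finset.sum_congr rfl fun i _ => DirectSum.coeAddMonoidHom_of _ _ _
    rw [h, AddSubmonoidClass.coe_finsetSum]
    exact (Polynomial.as_sum_support (f : Polynomial R)).symm
  right_inv := by
    intro x
    induction x using DirectSum.induction_on with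
    | zero =>
      refine DFinsupp.ext fun i => ?_
      rw [map_zero, reesDecompose_apply]
      apply Subtype.ext
      apply Subtype.ext
      exact map_zero _
    | of i x =>
      refine DFinsupp.ext fun j => ?_
      rw [DirectSum.coeAddMonoidHom_of, reesDecompose_apply]
      by_cases h : j = i
      · subst h
        rw [reesComponent_of_mem, DirectSum.of_eq_same]
      · rw [reesComponent_of_mem_ne I x h, DirectSum.of_eq_of_ne _ _ _ h]
    | add x y hx hy =>
      refine DFinsupp.ext fun i => ?_
      rw [map_add, reesDecompose_apply, reesComponent_add, ← reesDecompose_apply,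
        ← reesDecompose_apply, hx, hy]
      rfl

noncomputable instance reesPiece_gradedAlgebra : GradedAlgebra (reesPiece I) where

/-- The blowup of `Spec R` with center the ideal `I`: the scheme `Proj (⨁ i, I ^ i)`. -/
noncomputable def blowup : Scheme.{u} := Proj (reesPiece I)

/-- The blowup map from the blowup to `Spec R`. -/
noncomputable def blowupMap : blowup I ⟶ Spec (CommRingCat.of R) :=
  Proj.toSpecZero (reesPiece I) ≫
    Spec.map (CommRingCat.ofHom (algebraMap R (reesPiece I 0)))

end Rees

/-- An ideal of `F[x₁, …, xₙ]` is tame if the blowup of affine `n`-space over `F` with center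
this ideal is a smooth `F`-scheme. -/
def IsTame {F : Type u} [Field F] {n : ℕ} (I : Ideal (MvPolynomial (Fin n) F)) : Prop :=
  Smooth (blowupMap I ≫
    Spec.map (CommRingCat.ofHom (algebraMap F (MvPolynomial (Fin n) F))))

/-- The coordinate ideal of `F[x₁, …, xₙ]` with cloud `I`, that is, the ideal generated by the
variables `xᵢ` with `i ∈ I`. -/
noncomputable def coordinateIdeal (F : Type u) [Field F] {n : ℕ} (I : Set (Fin n)) :
    Ideal (MvPolynomial (Fin n) F) :=
  Ideal.span (MvPolynomial.X '' I)

end BlowupTame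

namespace BlowupTame

open HomogeneousLocalization

/-! Part (a) is a special case of (b). For (b), the blowup of the product `A` is covered by charts
`D₊(p)` with `p = x_a x_b x_c`, `a ∈ I`, `b ∈ J`, `c ∈ K`. The inclusions between the clouds always
allow a factorization `p² = m q` with `q ∈ A` and, up to permuting the clouds, `m = x_i² x_k`, where
`i ∈ I ∩ J` and `k ∈ K`. Then `D₊(p) ⊆ D₊(m)`, so the charts with a repeated index suffice
(`exists_isSmoothChart_of_double`).

Such a chart is an affine space (`isSmoothChart_coordinateIdeal`): a monomial substitution `φ` makes
all three ideals principal, and every variable is a quotient of the form `φ r / φ m ^ d` with `r ∈ A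
^ d`. By `exists_chart_equiv`, the coordinate ring of the chart is then the polynomial ring. -/

theorem exists_ringEquiv_of_range_eq {B S K : Type*} [CommRing B] [CommRing S] [CommRing K]
    {f : B →+* K} {g : S →+* K} (hf : Function.Injective f) (hg : Function.Injective g)
    (h : Set.range f = Set.range g) : ∃ e : B ≃+* S, ∀ b, g (e b) = f b := by
  have hrange : f.range = g.range := SetLike.coe_injective (by simpa using h)
  let e₁ := RingEquiv.ofBijective f.rangeRestrict
    ⟨fun a b h => hf (congrArg Subtype.val h), f.rangeRestrict_surjective⟩
  let e₂ := RingEquiv.ofBijective g.rangeRestrict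
    ⟨fun a b h => hg (congrArg Subtype.val h), g.rangeRestrict_surjective⟩
  refine ⟨e₁.trans ((RingEquiv.subringCongr hrange).trans e₂.symm), fun b => ?_⟩
  exact congrArg Subtype.val (e₂.apply_symm_apply (RingEquiv.subringCongr hrange (e₁ b)))

/-! ### Charts of a blowup and their coordinate rings -/

section Chart

variable {R : Type u} [CommRing R] {A : Ideal R}

/-- An element `m` of the ideal `A`, viewed in degree one of the Rees algebra. -/
noncomputable def reesT (m : A) : reesAlgebra A :=
  ⟨Polynomial.monomial 1 (m : R), reesAlgebra.monomial_mem.mpr (by simp)⟩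

theorem reesT_mem (m : A) : reesT m ∈ reesPiece A 1 := by
  intro j hj
  simp [reesT, Polynomial.coeff_monomial, hj.symm]

theorem reesT_add (m n : A) : reesT (m + n) = reesT m + reesT n :=
  Subtype.ext (by simp [reesT])

theorem reesT_smul (r : R) (m : A) : reesT (r • m) = algebraMap R (reesAlgebra A) r * reesT m :=
  Subtype.ext (by simp [reesT, Polynomial.C_mul_monomial])

theorem reesT_mul_reesT {m m' n n' : A} (h : (m * m' : R) = n * n') :
    reesT m * reesT m' = reesT n * reesT n' :=
  Subtype.ext (by simp [reesT, Polynomial.monomial_mul_monomial, h])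

/-- The open subset of the blowup on which `m` generates the pullback of the center. -/
noncomputable def chartOpen (m : A) : (blowup A).Opens :=
  Proj.basicOpen (reesPiece A) (reesT m)

/-- In the Rees algebra `(mt)² = (nt)(rt)`, so `nt` cannot vanish where `mt` does not. -/
theorem mem_chartOpen_of_mul_eq {x : blowup A} {m n : A} {r : R} (hr : r ∈ A)
    (h : (m * m : R) = n * r) (hx : x ∈ chartOpen m) : x ∈ chartOpen n := by
  have h₁ : x ∈ Proj.basicOpen (reesPiece A) (reesT m * reesT m) := by
    rw [Proj.basicOpen_mul]
    exact ⟨hx, hx⟩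
  rw [reesT_mul_reesT (n' := ⟨r, hr⟩) h, Proj.basicOpen_mul] at h₁
  exact h₁.1

/-- If an ideal is generated by `G`, then the chart opens of the blowup attached to the elements
of `G` cover it. -/
theorem exists_mem_chartOpen {G : Set R} (hG : A = Ideal.span G) (x : blowup A) :
    ∃ g : A, (g : R) ∈ G ∧ x ∈ chartOpen g := by
  by_contra! H
  have hx := ProjectiveSpectrum.not_irrelevant_le x
  have H1 : ∀ g : A, (g : R) ∈ G → reesT g ∈ x.asHomogeneousIdeal.toIdeal := by
    intro g hg
    by_contra h
    exact H g hg h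
  generalize x.asHomogeneousIdeal = p at *
  have H2 : ∀ m : A, reesT m ∈ p.toIdeal := by
    rintro ⟨m, hm⟩
    have hm' := hm
    rw [hG] at hm'
    induction hm' using Submodule.span_induction with
    | mem m h => exact H1 ⟨m, hm⟩ h
    | zero =>
      convert p.toIdeal.zero_mem
      exact Subtype.ext (by simp [reesT])
    | add m n h₁ h₂ ih₁ ih₂ =>
      replace h₁ : m ∈ A := hG ▸ h₁
      replace h₂ : n ∈ A := hG ▸ h₂
      exact reesT_add (A := A) ⟨m, h₁⟩ ⟨n, h₂⟩ ▸ p.toIdeal.add_mem (ih₁ h₁) (ih₂ h₂)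
    | smul r m h ih =>
      replace h : m ∈ A := hG ▸ h
      exact reesT_smul (A := A) r ⟨m, h⟩ ▸ p.toIdeal.mul_mem_left _ (ih h)
  -- The Rees algebra is generated in degree one over `R`, so `p` would contain the irrelevant
  -- ideal.
  have H3 : ∀ (d : ℕ) (r : R) (hr : r ∈ A ^ (d + 1)),
      (⟨Polynomial.monomial (d + 1) r, reesAlgebra.monomial_mem.mpr hr⟩ : reesAlgebra A) ∈
        p.toIdeal := by
    intro d r hr
    have hr' := hr
    rw [pow_succ] at hr'
    induction hr' using Submodule.mul_induction_on' with
    | mem_mul_mem a ha b hb =>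
      have := p.toIdeal.mul_mem_left
        ⟨Polynomial.monomial d a, reesAlgebra.monomial_mem.mpr ha⟩ (H2 ⟨b, hb⟩)
      convert this using 1
      exact Subtype.ext (by simp [reesT, Polynomial.monomial_mul_monomial])
    | add a ha b hb iha ihb =>
      rw [← pow_succ] at ha hb
      convert p.toIdeal.add_mem (iha ha) (ihb hb) using 1
      exact Subtype.ext (by simp)
  refine hx ?_
  intro f hf
  rw [HomogeneousIdeal.mem_irrelevant_iff] at hf
  have hf0 : (f : Polynomial R).coeff 0 = 0 := by
    have h : (reesComponent A f 0 : reesAlgebra A) = 0 := by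
      rw [← reesDecompose_apply]; exact hf
    have h' := congrArg (fun g : reesAlgebra A => (g : Polynomial R).coeff 0) h
    simpa [reesComponent] using h'
  have hsum : f = ∑ i ∈ (f : Polynomial R).support, (reesComponent A f i : reesAlgebra A) := by
    apply Subtype.ext
    rw [AddSubmonoidClass.coe_finsetSum]
    exact Polynomial.as_sum_support (f : Polynomial R)
  rw [hsum]
  refine p.toIdeal.sum_mem fun i hi => ?_
  obtain _ | d := i
  · simp [hf0] at hi
  · exact H3 d _ (f.2 (d + 1))

variable {B : Type u} [CommRing B] [IsDomain B] (φ : R →+* B) {m : A} (hm : φ m ≠ 0)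

/-- The evaluation of the Rees algebra at `t = 1 / φ m`. -/
noncomputable def reesEval (m : A) : reesAlgebra A →+* FractionRing B :=
  (Polynomial.eval₂RingHom ((algebraMap B (FractionRing B)).comp φ)
    (algebraMap B (FractionRing B) (φ m))⁻¹).comp (reesAlgebra A).val.toRingHom

theorem reesEval_of_mem {d : ℕ} {f : reesAlgebra A} (hf : f ∈ reesPiece A d) :
    reesEval φ m f = algebraMap B (FractionRing B) (φ ((f : Polynomial R).coeff d)) *
      ((algebraMap B (FractionRing B) (φ m))⁻¹) ^ d := by
  have h : (f : Polynomial R) = Polynomial.monomial d ((f : Polynomial R).coeff d) := by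
    ext j
    rw [Polynomial.coeff_monomial]
    split_ifs with h
    · rw [h]
    · exact hf j (Ne.symm h)
  change Polynomial.eval₂ _ _ (f : Polynomial R) = _
  conv_lhs => rw [h]
  rw [Polynomial.eval₂_monomial]
  rfl

include hm in
theorem reesEval_reesT : reesEval φ m (reesT m) = 1 := by
  rw [reesEval_of_mem φ (reesT_mem m)]
  have : algebraMap B (FractionRing B) (φ m) ≠ 0 := by simpa using hm
  simp [reesT, this]

/-- The map from the coordinate ring of a chart of the blowup to the fraction field of `B` that is
induced by `φ`. -/
noncomputable def chartEval : Away (reesPiece A) (reesT m) →+* FractionRing B :=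
  (Localization.awayLift (reesEval φ m) (reesT m)
    (by rw [reesEval_reesT φ hm]; exact isUnit_one)).comp
    (algebraMap (Away (reesPiece A) (reesT m)) (Localization.Away (reesT m)))

theorem chartEval_mk (n : ℕ) (f : reesAlgebra A) (hf : f ∈ reesPiece A (n • 1)) :
    chartEval φ hm (Away.mk (reesPiece A) (reesT_mem m) n f hf) =
      algebraMap B (FractionRing B) (φ ((f : Polynomial R).coeff n)) *
        ((algebraMap B (FractionRing B) (φ m))⁻¹) ^ n := by
  have h := Localization.awayLift_mk (reesEval φ m) (reesT m) f 1
    ((mul_one _).trans (reesEval_reesT φ hm)) n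
  refine h.trans (Eq.trans (by rw [one_pow, mul_one]) (reesEval_of_mem φ (by simpa using hf)))

theorem chartEval_algebraMap (r : R) :
    chartEval φ hm (fromZeroRingHom (reesPiece A) _ (algebraMap R (reesPiece A 0) r)) =
      algebraMap B (FractionRing B) (φ r) := by
  have h0 : (algebraMap R (reesPiece A 0) r : reesAlgebra A) ∈ reesPiece A (0 • 1) :=
    (algebraMap R (reesPiece A 0) r).2
  have h := chartEval_mk φ hm 0 (algebraMap R (reesPiece A 0) r : reesAlgebra A) h0
  have hc : (((algebraMap R (reesPiece A 0) r : reesPiece A 0) : reesAlgebra A) :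
      Polynomial R).coeff 0 = r := by
    change (Polynomial.C r).coeff 0 = r
    simp
  rw [hc, pow_zero, mul_one] at h
  rw [← h]
  congr 1

theorem chartEval_injective (hφ : Function.Injective φ) :
    Function.Injective (chartEval φ hm) := by
  rw [injective_iff_map_eq_zero]
  intro a ha
  obtain ⟨n, f, hf, rfl⟩ := Away.mk_surjective (reesPiece A) (reesT_mem m) a
  rw [chartEval_mk] at ha
  have hm' : algebraMap B (FractionRing B) (φ m) ≠ 0 := by simpa using hm
  have h0 : (f : Polynomial R).coeff n = 0 := by
    simpa [hm', map_eq_zero_iff φ hφ, hm] using ha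
  have hf0 : f = 0 := by
    apply Subtype.ext
    ext j
    by_cases hj : j = n
    · rw [hj, h0]; rfl
    · exact hf j (by simpa using hj)
  subst hf0
  apply HomogeneousLocalization.val_injective
  simp [Localization.mk_zero]

/-- By `hA`, `φ` sends `A ^ n` into the multiples of `φ m ^ n`, so fractions of degree zero take
values in `B`; `hs` writes each element of `B` as such a value. -/
theorem range_chartEval (hA : A.map φ ≤ Ideal.span {φ m})
    (hs : ∀ b, ∃ d, ∃ r ∈ A ^ d, φ r = b * φ m ^ d) :
    Set.range (chartEval φ hm) = Set.range (algebraMap B (FractionRing B)) := by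
  have hm' : algebraMap B (FractionRing B) (φ m) ≠ 0 := by simpa using hm
  apply Set.Subset.antisymm
  · rintro _ ⟨a, rfl⟩
    obtain ⟨n, f, hf, rfl⟩ := Away.mk_surjective (reesPiece A) (reesT_mem m) a
    have hmem : φ ((f : Polynomial R).coeff n) ∈ Ideal.span {φ m ^ n} := by
      rw [← Ideal.span_singleton_pow]
      refine Ideal.pow_right_mono hA n ?_
      rw [← Ideal.map_pow]
      exact Ideal.mem_map_of_mem φ (f.2 n)
    obtain ⟨b, hb⟩ := Ideal.mem_span_singleton'.mp hmem
    refine ⟨b, ?_⟩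
    rw [chartEval_mk, ← hb]
    rw [map_mul, map_pow, mul_assoc, ← mul_pow, mul_inv_cancel₀ hm', one_pow, mul_one]
  · rintro _ ⟨b, rfl⟩
    obtain ⟨d, r, hr, hb⟩ := hs b
    let f : reesAlgebra A := ⟨Polynomial.monomial d r, reesAlgebra.monomial_mem.mpr hr⟩
    have hf : f ∈ reesPiece A (d • 1) := by
      intro j hj
      simp only [smul_eq_mul, mul_one] at hj
      simp [f, Polynomial.coeff_monomial, hj.symm]
    refine ⟨Away.mk (reesPiece A) (reesT_mem m) d f hf, ?_⟩
    rw [chartEval_mk]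
    simp only [f, Polynomial.coeff_monomial, if_true, hb]
    rw [map_mul, map_pow, mul_assoc, ← mul_pow, mul_inv_cancel₀ hm', one_pow, mul_one]

/-- The chart `D₊(m)` of the blowup of `A` is `Spec B`, if the inclusion `φ : R → B` turns `A` into
the principal ideal generated by `φ m`, and `B` is generated by the quotients `φ r / φ m ^ d` with
`r ∈ A ^ d`. -/
theorem exists_chart_equiv (hm : φ m ≠ 0) (hφ : Function.Injective φ)
    (hA : A.map φ ≤ Ideal.span {φ m})
    (hs : ∀ b, ∃ d, ∃ r ∈ A ^ d, φ r = b * φ m ^ d) :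
    ∃ e : B ≃+* Away (reesPiece A) (reesT m), ∀ r,
      e (φ r) = fromZeroRingHom (reesPiece A) _ (algebraMap R (reesPiece A 0) r) := by
  have hinj := chartEval_injective φ hm hφ
  obtain ⟨e, he⟩ := exists_ringEquiv_of_range_eq (IsFractionRing.injective B (FractionRing B)) hinj
    (range_chartEval φ hm hA hs).symm
  refine ⟨e, fun r => hinj ?_⟩
  rw [chartEval_algebraMap]
  exact he _

end Chart

/-! ### Smoothness from charts that are affine spaces -/

section Smooth

variable {F : Type u} [Field F] {n : ℕ}

/-- The chart of the blowup of `A` at `m` is smooth over `F`. -/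
def IsSmoothChart {A : Ideal (MvPolynomial (Fin n) F)} (m : A) : Prop :=
  ((fromZeroRingHom (reesPiece A) (Submonoid.powers (reesT m))).comp
    ((algebraMap _ (reesPiece A 0)).comp (algebraMap F (MvPolynomial (Fin n) F)))).Smooth

theorem isTame_of_isSmoothChart {A : Ideal (MvPolynomial (Fin n) F)}
    (h : ∀ x : blowup A, ∃ m : A, IsSmoothChart m ∧ x ∈ chartOpen m) :
    IsTame A := by
  let U : {m : A // IsSmoothChart m} → (Proj (reesPiece A)).Opens :=
    fun m => Proj.basicOpen (reesPiece A) (reesT m.1)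
  have hU : iSup U = ⊤ := by
    refine top_le_iff.mp fun x _ => TopologicalSpace.Opens.mem_iSup.mpr ?_
    obtain ⟨m, hm, hx⟩ := h x
    exact ⟨⟨m, hm⟩, hx⟩
  let f : Proj (reesPiece A) ⟶ Spec (CommRingCat.of F) :=
    (Proj.toSpecZero (reesPiece A) ≫ Spec.map (CommRingCat.ofHom (algebraMap _ _))) ≫
      Spec.map (CommRingCat.ofHom (algebraMap F (MvPolynomial (Fin n) F)))
  change Smooth f
  have hloc : IsZariskiLocalAtSource @Smooth.{u}  :=
    HasRingHomProperty.instIsZariskiLocalAtSource (Q := RingHom.Smooth)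
  refine (IsZariskiLocalAtSource.iff_of_iSup_eq_top (P := @Smooth.{u}) U hU).mpr ?_
  rintro ⟨m, hm⟩
  have hι : (U ⟨m, hm⟩).ι = (Proj.basicOpenIsoSpec (reesPiece A) _ (reesT_mem m) one_pos).hom ≫
      Proj.awayι (reesPiece A) _ (reesT_mem m) one_pos := by
    rw [← Proj.basicOpenIsoSpec_inv_ι, Iso.hom_inv_id_assoc]
  have hsm : Smooth (Proj.awayι (reesPiece A) _ (reesT_mem m) one_pos ≫ f) := by
    have heq : Proj.awayι (reesPiece A) _ (reesT_mem m) one_pos ≫ f =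
        Spec.map (CommRingCat.ofHom
          ((fromZeroRingHom (reesPiece A) (Submonoid.powers (reesT m))).comp
            ((algebraMap _ (reesPiece A 0)).comp (algebraMap F (MvPolynomial (Fin n) F))))) := by
      dsimp only [f]
      rw [Category.assoc, Proj.awayι_toSpecZero_assoc, ← Spec.map_comp, ← Spec.map_comp]
      rfl
    rw [heq]
    exact HasRingHomProperty.Spec_iff.mpr hm
  rw [hι, Category.assoc]
  infer_instance

theorem isSmoothChart_of_algHom {A : Ideal (MvPolynomial (Fin n) F)} {m : A}
    (φ : MvPolynomial (Fin n) F →ₐ[F] MvPolynomial (Fin n) F) (hφ : Function.Injective φ)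
    (hm : (m : MvPolynomial (Fin n) F) ≠ 0) (hA : A.map φ ≤ Ideal.span {φ m})
    (hs : ∀ i, ∃ d, ∃ r ∈ A ^ d, φ r = MvPolynomial.X i * φ m ^ d) : IsSmoothChart m := by
  have hs' : ∀ b, ∃ d, ∃ r ∈ A ^ d, φ r = b * φ m ^ d := by
    -- Raising the exponent of the denominator gives sums a common one; hence checking the variables
    -- is enough.
    have hlift : ∀ {b d r} (e : ℕ), r ∈ A ^ d → φ r = b * φ m ^ d →
        r * m ^ e ∈ A ^ (d + e) ∧ φ (r * m ^ e) = b * φ m ^ (d + e) := by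
      intro b d r e hr h
      refine ⟨pow_add A d e ▸ Ideal.mul_mem_mul hr (Ideal.pow_mem_pow m.2 e), ?_⟩
      rw [map_mul, map_pow, h]
      ring
    intro b
    induction b using MvPolynomial.induction_on with
    | C a => exact ⟨0, MvPolynomial.C a, by simp, by simp [← MvPolynomial.algebraMap_eq]⟩
    | add p q hp hq =>
      obtain ⟨d, r, hr, h⟩ := hp
      obtain ⟨d', r', hr', h'⟩ := hq
      obtain ⟨h₁, h₂⟩ := hlift d' hr h
      obtain ⟨h₃, h₄⟩ := hlift d hr' h'
      rw [add_comm d' d] at h₃ h₄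
      exact ⟨d + d', _, add_mem h₁ h₃, by rw [map_add, h₂, h₄, add_mul]⟩
    | mul_X p i hp =>
      obtain ⟨d, r, hr, h⟩ := hp
      obtain ⟨d', r', hr', h'⟩ := hs i
      refine ⟨d + d', r * r', pow_add A d d' ▸ Ideal.mul_mem_mul hr hr', ?_⟩
      rw [map_mul, h, h']
      ring
  have hm' : φ.toRingHom m ≠ 0 := by
    simpa using (map_ne_zero_iff φ hφ).mpr hm
  obtain ⟨e, he⟩ := exists_chart_equiv φ.toRingHom hm' hφ hA hs'
  have hP : (algebraMap F (MvPolynomial (Fin n) F)).Smooth :=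
    RingHom.smooth_algebraMap.mpr ⟨inferInstance, inferInstance⟩
  let e' : MvPolynomial (Fin n) F →+* Away (reesPiece A) (reesT m) := RingHomClass.toRingHom e
  have he' : e'.Smooth :=
    RingHom.Smooth.holdsForLocalizationAway.of_bijective e' _ e.bijective
  have hcomp : (fromZeroRingHom (reesPiece A) (Submonoid.powers (reesT m))).comp
      ((algebraMap _ (reesPiece A 0)).comp (algebraMap F (MvPolynomial (Fin n) F))) =
      e'.comp (algebraMap F (MvPolynomial (Fin n) F)) := by
    refine RingHom.ext fun a => ?_
    refine (he (algebraMap F _ a)).symm.trans (congrArg e ?_)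
    exact φ.commutes a
  rw [IsSmoothChart, hcomp]
  exact hP.comp he'

end Smooth

/-! ### Monomial charts for products of three coordinate ideals -/

section MonomialCharts

open MvPolynomial

variable {F : Type u} [Field F] {n : ℕ}

open Classical in
/-- The substitution that multiplies the variables in `U` by `xᵢ` and those in `V` by `xₖ`. -/
noncomputable def monomialSubst (F : Type u) [Field F] (i k : Fin n) (U V : Set (Fin n)) :
    MvPolynomial (Fin n) F →ₐ[F] MvPolynomial (Fin n) F :=
  aeval fun l => X l * (if l ∈ U then X i else 1) * (if l ∈ V then X k else 1)

open Classical in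
theorem monomialSubst_X (i k : Fin n) (U V : Set (Fin n)) (l : Fin n) :
    monomialSubst F i k U V (X l) =
      X l * (if l ∈ U then X i else 1) * (if l ∈ V then X k else 1) :=
  aeval_X _ _

theorem monomialSubst_injective {i k : Fin n} {U V : Set (Fin n)} (hiU : i ∉ U) (hiV : i ∉ V)
    (hkV : k ∉ V) : Function.Injective (monomialSubst F i k U V) := by
  classical
  let L := FractionRing (MvPolynomial (Fin n) F)
  let x : Fin n → L := fun l => algebraMap (MvPolynomial (Fin n) F) L (X l)
  have hx : ∀ l, x l ≠ 0 := fun l => by simp [x, X_ne_zero]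
  -- A left inverse over the fraction field: `k` may lie in `U`, so the division for `V` must use `y
  -- k`, not `x k`.
  let y : Fin n → L := fun l => x l / (if l ∈ U then x i else 1)
  have hy : ∀ l, y l ≠ 0 := fun l => by
    dsimp only [y]
    split_ifs <;> simp [hx]
  let ψ : MvPolynomial (Fin n) F →ₐ[F] L := aeval fun l => y l / (if l ∈ V then y k else 1)
  have hcomp : ψ.comp (monomialSubst F i k U V) =
      IsScalarTower.toAlgHom F (MvPolynomial (Fin n) F) L := by
    ext l
    have hψi : ψ (X i) = x i := by simp [ψ, y, hiU, hiV]
    have hψk : ψ (X k) = y k := by simp [ψ, hkV]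
    have hψl : ψ (X l) = y l / (if l ∈ V then y k else 1) := by simp [ψ]
    have hyl : y l = x l / (if l ∈ U then x i else 1) := rfl
    have h : ψ (monomialSubst F i k U V (X l)) = x l := by
      rw [monomialSubst_X, map_mul, map_mul, apply_ite ψ, apply_ite ψ, hψi, hψk, map_one, hψl]
      have hu : (if l ∈ U then x i else 1) ≠ 0 := by split_ifs <;> simp [hx]
      have hv : (if l ∈ V then y k else 1) ≠ 0 := by split_ifs <;> simp [hy]
      rw [mul_right_comm, div_mul_cancel₀ _ hv, hyl, div_mul_cancel₀ _ hu]
    exact h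
  have hinj : Function.Injective (ψ.comp (monomialSubst F i k U V)) := by
    rw [hcomp]
    exact IsFractionRing.injective (MvPolynomial (Fin n) F) L
  exact Function.Injective.of_comp (f := ψ) hinj

theorem map_coordinateIdeal_le {φ : MvPolynomial (Fin n) F →ₐ[F] MvPolynomial (Fin n) F}
    {I : Set (Fin n)} {p : MvPolynomial (Fin n) F} (h : ∀ l ∈ I, p ∣ φ (X l)) :
    (coordinateIdeal F I).map φ ≤ Ideal.span {p} := by
  rw [coordinateIdeal, Ideal.map_span, Ideal.span_le]
  rintro _ ⟨_, ⟨l, hl, rfl⟩, rfl⟩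
  exact Ideal.mem_span_singleton.mpr (h l hl)

theorem X_mem_coordinateIdeal {I : Set (Fin n)} {l : Fin n} (hl : l ∈ I) :
    (X l : MvPolynomial (Fin n) F) ∈ coordinateIdeal F I :=
  Ideal.subset_span ⟨l, hl, rfl⟩

theorem X_mul_X_mul_X_mem {I J K : Set (Fin n)} {a b c : Fin n} (ha : a ∈ I) (hb : b ∈ J)
    (hc : c ∈ K) : (X a * X b * X c : MvPolynomial (Fin n) F) ∈
      coordinateIdeal F I * coordinateIdeal F J * coordinateIdeal F K :=
  Ideal.mul_mem_mul (Ideal.mul_mem_mul (X_mem_coordinateIdeal ha) (X_mem_coordinateIdeal hb))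
    (X_mem_coordinateIdeal hc)

/-- Scaling the other variables of `I ∪ J` by `x_i` makes the ideals of `I` and `J` principal,
generated by `x_i`. If `i ∈ K`, the same holds for `K`. Otherwise all variables of `K` acquire the
factor `x_i`, and a further scaling by `x_k` makes `φ (x_k) = x_k x_i` divide them all. -/
theorem isSmoothChart_coordinateIdeal {I J K : Set (Fin n)} {A : Ideal (MvPolynomial (Fin n) F)}
    (hA : A = coordinateIdeal F I * coordinateIdeal F J * coordinateIdeal F K)
    (hK : K ⊆ I ∪ J) {i k : Fin n} (hiI : i ∈ I) (hiJ : i ∈ J) (hk : k ∈ K) (hik : i ∈ K → k = i)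
    {m : A} (hm : (m : MvPolynomial (Fin n) F) = X i * X i * X k) : IsSmoothChart m := by
  classical
  let U : Set (Fin n) := (I ∪ J) \ {i}
  let V : Set (Fin n) := {l | i ∉ K ∧ l ∈ K ∧ l ≠ k}
  have hiU : i ∉ U := fun h => h.2 rfl
  have hiV : i ∉ V := fun h => h.1 h.2.1
  have hkV : k ∉ V := fun h => h.2.2 rfl
  have hVU : ∀ l ∈ V, l ∈ U := fun l hl => ⟨hK hl.2.1, fun h => hl.1 (h ▸ hl.2.1)⟩
  let φ := monomialSubst F i k U V
  have hφi : φ (X i) = X i := by simp [φ, monomialSubst_X, hiU, hiV]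
  have hφk : i ∉ K → φ (X k) = X k * X i := fun h => by
    have hkU : k ∈ U := ⟨hK hk, fun h' => h (h' ▸ hk)⟩
    simp [φ, monomialSubst_X, hkU, hkV]
  have hφU : ∀ l ∈ U, l ∉ V → φ (X l) = X l * X i := fun l hl hl' => by
    simp [φ, monomialSubst_X, hl, hl']
  have hφV : ∀ l ∈ V, φ (X l) = X l * X i * X k := fun l hl => by
    simp [φ, monomialSubst_X, hVU l hl, hl]
  have hdvd : ∀ l ∈ I ∪ J, X i ∣ φ (X l) := by
    intro l hl
    by_cases hli : l = i
    · rw [hli, hφi]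
    · have hlU : l ∈ U := ⟨hl, hli⟩
      simp only [φ, monomialSubst_X, if_pos hlU]
      exact (Dvd.intro_left _ rfl).mul_right _
  have hdvdK : ∀ l ∈ K, φ (X k) ∣ φ (X l) := by
    intro l hl
    by_cases hiK : i ∈ K
    · rw [hik hiK, hφi]
      exact hdvd l (hK hl)
    · by_cases hlk : l = k
      · rw [hlk]
      · rw [hφk hiK, hφV l ⟨hiK, hl, hlk⟩]
        exact ⟨X l, by ring⟩
  have hφm : φ m = X i * X i * φ (X k) := by rw [hm, map_mul, map_mul, hφi]
  refine isSmoothChart_of_algHom φ (monomialSubst_injective hiU hiV hkV) ?_ ?_ ?_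
  · rw [hm]
    exact mul_ne_zero (mul_ne_zero (X_ne_zero i) (X_ne_zero i)) (X_ne_zero k)
  · conv_lhs => rw [hA]
    rw [Ideal.map_mul, Ideal.map_mul, hφm, ← Ideal.span_singleton_mul_span_singleton,
      ← Ideal.span_singleton_mul_span_singleton]
    exact Ideal.mul_mono (Ideal.mul_mono
      (map_coordinateIdeal_le fun l hl => hdvd l (Or.inl hl))
      (map_coordinateIdeal_le fun l hl => hdvd l (Or.inr hl)))
      (map_coordinateIdeal_le hdvdK)
  -- To recover `x_l`, one factor of `m` is replaced by `x_l`: the factor from `K` for `l ∈ V`,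
  -- otherwise one from `I` or `J`. Variables outside `U` and `V` are fixed by `φ`.
  · intro l
    by_cases hlV : l ∈ V
    · refine ⟨1, X i * X i * X l, ?_, ?_⟩
      · rw [pow_one, hA]
        exact X_mul_X_mul_X_mem hiI hiJ hlV.2.1
      · rw [pow_one, hφm, map_mul, map_mul, hφi, hφV l hlV, hφk hlV.1]
        ring
    · by_cases hlU : l ∈ U
      · obtain hl | hl := hlU.1
        · refine ⟨1, X l * X i * X k, ?_, ?_⟩
          · rw [pow_one, hA]
            exact X_mul_X_mul_X_mem hl hiJ hk
          · rw [pow_one, hφm, map_mul, map_mul, hφi, hφU l hlU hlV]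
            ring
        · refine ⟨1, X i * X l * X k, ?_, ?_⟩
          · rw [pow_one, hA]
            exact X_mul_X_mul_X_mem hiI hl hk
          · rw [pow_one, hφm, map_mul, map_mul, hφi, hφU l hlU hlV]
            ring
      · exact ⟨0, X l, by simp, by simp [φ, monomialSubst_X, hlU, hlV]⟩

theorem coordinateIdeal_mul_mul_eq_span (I J K : Set (Fin n)) :
    coordinateIdeal F I * coordinateIdeal F J * coordinateIdeal F K =
      Ideal.span {p | ∃ a ∈ I, ∃ b ∈ J, ∃ c ∈ K, p = X a * X b * X c} := by
  rw [coordinateIdeal, coordinateIdeal, coordinateIdeal, Ideal.span_mul_span', Ideal.span_mul_span']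
  congr 1
  ext p
  constructor
  · rintro ⟨_, ⟨_, ⟨a, ha, rfl⟩, _, ⟨b, hb, rfl⟩, rfl⟩, _, ⟨c, hc, rfl⟩, rfl⟩
    exact ⟨a, ha, b, hb, c, hc, rfl⟩
  · rintro ⟨a, ha, b, hb, c, hc, rfl⟩
    exact ⟨_, ⟨_, ⟨a, ha, rfl⟩, _, ⟨b, hb, rfl⟩, rfl⟩, _, ⟨c, hc, rfl⟩, rfl⟩

theorem exists_isSmoothChart_of_double {I J K : Set (Fin n)} {A : Ideal (MvPolynomial (Fin n) F)}
    (hA : A = coordinateIdeal F I * coordinateIdeal F J * coordinateIdeal F K)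
    (hK : K ⊆ I ∪ J) {i k : Fin n} (hiI : i ∈ I) (hiJ : i ∈ J) (hk : k ∈ K) {x : blowup A}
    {p : A} {q : MvPolynomial (Fin n) F} (hq : q ∈ A)
    (hp : (p * p : MvPolynomial (Fin n) F) = X i * X i * X k * q) (hx : x ∈ chartOpen p) :
    ∃ m : A, IsSmoothChart m ∧ x ∈ chartOpen m := by
  have hmem : ∀ {a b c : Fin n}, a ∈ I → b ∈ J → c ∈ K →
      (X a * X b * X c : MvPolynomial (Fin n) F) ∈ A :=
    fun ha hb hc => hA ▸ X_mul_X_mul_X_mem ha hb hc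
  let m : A := ⟨X i * X i * X k, hmem hiI hiJ hk⟩
  have hxm : x ∈ chartOpen m := mem_chartOpen_of_mul_eq hq hp hx
  by_cases hiK : i ∈ K
  -- Here `k` need not be `i`, so the chart of `x_i³` is used: `(x_i² x_k)² = x_i³ · (x_k² x_i)`,
  -- and `x_k² x_i ∈ A` because `k` also lies in `I` or `J`.
  · let m' : A := ⟨X i * X i * X i, hmem hiI hiJ hiK⟩
    refine ⟨m', isSmoothChart_coordinateIdeal hA hK hiI hiJ hiK (fun _ => rfl) rfl, ?_⟩
    obtain hkI | hkJ := hK hk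
    · exact mem_chartOpen_of_mul_eq (hmem hkI hiJ hk) (by simp only [m, m']; ring) hxm
    · exact mem_chartOpen_of_mul_eq (hmem hiI hkJ hk) (by simp only [m, m']; ring) hxm
  · exact ⟨m, isSmoothChart_coordinateIdeal hA hK hiI hiJ hk (fun h => absurd h hiK) rfl, hxm⟩

/-- The product of three coordinate ideals is tame if each cloud is contained in the union of the
other two. -/
theorem isTame_mul_mul_of_subset_union {I J K : Set (Fin n)} (hI : I ⊆ J ∪ K) (hJ : J ⊆ K ∪ I)
    (hK : K ⊆ I ∪ J) :
    IsTame (coordinateIdeal F I * coordinateIdeal F J * coordinateIdeal F K) := by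
  generalize hA : coordinateIdeal F I * coordinateIdeal F J * coordinateIdeal F K = A
  have hA₁ : A = coordinateIdeal F I * coordinateIdeal F J * coordinateIdeal F K := hA.symm
  have hA₂ : A = coordinateIdeal F J * coordinateIdeal F K * coordinateIdeal F I := by
    rw [hA₁]; ring
  have hA₃ : A = coordinateIdeal F K * coordinateIdeal F I * coordinateIdeal F J := by
    rw [hA₁]; ring
  have hmem : ∀ {a b c : Fin n}, a ∈ I → b ∈ J → c ∈ K →
      (X a * X b * X c : MvPolynomial (Fin n) F) ∈ A :=
    fun ha hb hc => hA ▸ X_mul_X_mul_X_mem ha hb hc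
  refine isTame_of_isSmoothChart fun x => ?_
  obtain ⟨p, ⟨a, ha, b, hb, c, hc, hp⟩, hx⟩ :=
    exists_mem_chartOpen (hA₁.trans (coordinateIdeal_mul_mul_eq_span I J K)) x
  by_cases hab : a ∈ J ∧ b ∈ I
  · exact exists_isSmoothChart_of_double hA₁ hK ha hab.1 hc (hmem hab.2 hb hc)
      (by rw [hp]; ring) hx
  by_cases hbc : b ∈ K ∧ c ∈ J
  · exact exists_isSmoothChart_of_double hA₂ hI hb hbc.1 ha (hmem ha hbc.2 hc)
      (by rw [hp]; ring) hx
  by_cases hca : c ∈ I ∧ a ∈ K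
  · exact exists_isSmoothChart_of_double hA₃ hJ hca.2 ha hb (hmem hca.1 hb hc)
      (by rw [hp]; ring) hx
  -- No two of `a, b, c` can swap their clouds, so all three move cyclically. If `a ∈ J`, then `b ∈
  -- K`, `c ∈ I` and `p² = (x_a² x_b)(x_c² x_b)`; if `a ∈ K`, the cycle runs the other way and `p² =
  -- (x_a² x_c)(x_b² x_c)`.
  obtain haJ | haK := hI ha
  · have hbK : b ∈ K := (hJ hb).resolve_right fun h => hab ⟨haJ, h⟩
    have hcI : c ∈ I := (hK hc).resolve_right fun h => hbc ⟨hbK, h⟩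
    exact exists_isSmoothChart_of_double hA₁ hK ha haJ hbK (hmem hcI hb hc)
      (by rw [hp]; ring) hx
  · have hcJ : c ∈ J := (hK hc).resolve_left fun h => hca ⟨h, haK⟩
    have hbI : b ∈ I := (hJ hb).resolve_left fun h => hbc ⟨h, hcJ⟩
    exact exists_isSmoothChart_of_double hA₃ hJ haK ha hcJ (hmem hbI hb hc)
      (by rw [hp]; ring) hx

end MonomialCharts

end BlowupTame

theorem mainTheorem12 (F : Type u) [Field F] (n : ℕ) :
    (∀ I J K : Set (Fin n), I ∪ J = K →
      BlowupTame.IsTame (BlowupTame.coordinateIdeal F I * BlowupTame.coordinateIdeal F J *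
        BlowupTame.coordinateIdeal F K)) ∧
    (∀ I J K : Set (Fin n), I ⊆ J ∪ K → J ⊆ K ∪ I → K ⊆ I ∪ J →
      BlowupTame.IsTame (BlowupTame.coordinateIdeal F I * BlowupTame.coordinateIdeal F J *
        BlowupTame.coordinateIdeal F K)) := by
  refine ⟨?_, fun I J K hI hJ hK => BlowupTame.isTame_mul_mul_of_subset_union hI hJ hK⟩
  rintro I J K rfl
  exact BlowupTame.isTame_mul_mul_of_subset_union
    (fun _ h => Or.inr (Or.inl h)) (fun _ h => Or.inl (Or.inr h)) subset_rfl
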